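/- Let $E,H,K$ be Hilbert spaces (all real or all complex) and let $A\in\mathbf B(E,H)$, $B\in\mathbf B(E,K)$ be bounded linear operators. Notation. For bounded operators $S,T$ on $E$ (with values in possibly different Hilbert spaces), $T$ is *dominated* by $S$ if $\|Tf\|\le c\|Sf\|$ for all $f\in E$ and some $c>0$. $T$ is *almost dominated* by $S$ if there are Hilbert spaces $K_n$, operators $T_n\in\mathbf B(E,K_n)$ and constants $c_n\ge 0$ such that for all $f\in E$ and all $n$: $\|T_nf\|\le c_n\|Sf\|$, $\|T_nf\|\le\|T_{n+1}f\|$, and $\|T_nf\|\to\|Tf\|$ as $n\to\infty$. $T$ is *singular* with respect to $S$ if the only $D\in\mathbf B(E)$ dominated by both $S$ and $T$ is $D=0$. A *Lebesgue type decomposition* of $B$ with respect to $A$ is a decomposition $B=B_1+B_2$ with $B_1,B_2\in\mathbf B(E,K)$, $\operatorname{ran}B_1\perp\operatorname{ran}B_2$, $B_1$ almost dominated by $A$, and $B_2$ singular with respect to $A$. Put $$\mathfrak D(A,B)=\{k\in K:\ B^*k\in\operatorname{ran}A^*\},\qquad L(A,B)=\{\{Af,Bf\}:\ f\in E\}\subset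 H\times K .$$ For a linear relation $T\subset H\times K$, $T^*=\{\{k,h\}\in K\times H:\ (g,k)=(f,h)\text{ for all }\{f,g\}\in T\}$; $T$ is *regular* if its closure is (the graph of) an operator, and *singular* if its closure is a product of closed linear subspaces of $H$ and $K$. For linear relations $T_1,T_2\subset H\times K$ and $P\in\mathbf B(K)$, $T_1+T_2=\{\{h,k_1+k_2\}:\{h,k_1\}\in T_1,\{h,k_2\}\in T_2\}$ and $PT_1=\{\{h,Pk\}:\{h,k\}\in T_1\}$. Theorem. The Lebesgue type decompositions $B=B_1+B_2$ of $B$ with respect to $A$ are in one-to-one correspondence with the closed linear subspaces $\mathfrak L\subset K$ such that $$\mathfrak L\setminus\{0\}\subset \operatorname{clos}\mathfrak D(A,B)\setminus\mathfrak D(A,B)\quad\text{and}\quad \operatorname{clos}\bigl(\mathfrak L^\perp\cap\mathfrak D(A,B)\bigr)=\mathfrak L^\perp\cap\operatorname{clos}\mathfrak D(A,B).$$ The correspondence assigns to $\mathfrak L$ the decomposition $$B_1=(I-P_{\mathfrak M})B,\qquad B_2=P_{\mathfrak M}B,$$ where $P_{\mathfrak M}$ is the orthogonal projection of $K$ onto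 $\mathfrak M=\mathfrak D(A,B)^\perp\oplus\mathfrak L$. Moreover, for every such $\mathfrak L$ and the corresponding $B_1,B_2$: 1. $R(A,B_1):=L(A,B_1)^{**}$ (the Radon-Nikodym derivative of $B_1$ with respect to $A$) is a closed linear operator from $H$ to $K$, and $B_1=R(A,B_1)A$. 2. $L(A,B_1)$ is regular, $L(A,B_2)$ is singular, and for linear relations $T_1,T_2\subset H\times K$ one has $$L(A,B)=T_1+T_2,\quad T_1=(I-P_{\mathfrak M})L(A,B),\quad T_2=P_{\mathfrak M}L(A,B)$$ if and only if $T_1=L(A,B_1)$ and $T_2=L(A,B_2)$. -/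

import Mathlib

namespace OpLebesgue

universe u v w x

section Pairs

variable {𝕜 : Type x} [RCLike 𝕜]
  {E : Type u} [NormedAddCommGroup E] [InnerProductSpace 𝕜 E]
  {H : Type v} [NormedAddCommGroup H] [InnerProductSpace 𝕜 H]
  {K : Type w} [NormedAddCommGroup K] [InnerProductSpace 𝕜 K]

/-- `B ≺ A`: the operator `B` is dominated by `A`. -/
def Dominated (A : E →L[𝕜] H) (B : E →L[𝕜] K) : Prop :=
  ∃ c : ℝ, 0 < c ∧ ∀ f : E, ‖B f‖ ≤ c * ‖A f‖

/-- `B` is almost dominated by `A`: there are Hilbert spaces `X n`, operators `T n ∈ B(E, X n)` and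
constants `c n ≥ 0` with `‖T n f‖ ≤ c n ‖A f‖` and `‖T n f‖ ↗ ‖B f‖` for all `f`.
The universe of the `X n` is no restriction: since `‖T n f‖ ≤ ‖B f‖`, each `T n` may be replaced by
an operator with the same norms `‖T n f‖` whose values lie in `K`, hence in `K ⊕ H`. -/
def AlmostDominated (A : E →L[𝕜] H) (B : E →L[𝕜] K) : Prop :=
  ∃ (X : ℕ → Type (max v w)) (_ : ∀ n, NormedAddCommGroup (X n))
    (_ : ∀ n, InnerProductSpace 𝕜 (X n)) (_ : ∀ n, CompleteSpace (X n))
    (T : ∀ n, E →L[𝕜] X n) (c : ℕ → ℝ),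
    (∀ n, 0 ≤ c n) ∧
    ∀ f : E,
      (∀ n, ‖T n f‖ ≤ c n * ‖A f‖) ∧
      (∀ n, ‖T n f‖ ≤ ‖T (n + 1) f‖) ∧
      Filter.Tendsto (fun n => ‖T n f‖) Filter.atTop (nhds ‖B f‖)

/-- `B` is singular with respect to `A`: the only `D ∈ B(E)` dominated by both is `0`. -/
def SingularTo (A : E →L[𝕜] H) (B : E →L[𝕜] K) : Prop :=
  ∀ D : E →L[𝕜] E, Dominated A D → Dominated B D → D = 0

/-- `B = B₁ + B₂` is a Lebesgue type decomposition of `B` with respect to `A`. -/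
structure IsLebesgueTypeDecomposition (A : E →L[𝕜] H) (B B₁ B₂ : E →L[𝕜] K) : Prop where
  eq_add : B = B₁ + B₂
  ran_orthogonal : ∀ f g : E, inner 𝕜 (B₁ f) (B₂ g) = 0
  almostDominated : AlmostDominated A B₁
  singular : SingularTo A B₂

/-- The linear relation `L(A,B) = {{Af, Bf} : f ∈ E}` from `H` to `K`. -/
def rel (A : E →L[𝕜] H) (B : E →L[𝕜] K) : Submodule 𝕜 (H × K) :=
  LinearMap.range ((A : E →ₗ[𝕜] H).prod (B : E →ₗ[𝕜] K))

/-- The operator part `R(A,B)` with graph `L(A,B)**`, as a partially defined operator from `H` to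
`K`. This is meaningful when `B` is almost dominated by `A`, so that `L(A,B)**` is (the graph of) an
operator. -/
noncomputable def radonNikodym (A : E →L[𝕜] H) (B : E →L[𝕜] K) : H →ₗ.[𝕜] K :=
  (rel A B).adjoint.adjoint.toLinearPMap

end Pairs

section Relations

variable {𝕜 : Type x} [RCLike 𝕜]
  {H : Type v} [NormedAddCommGroup H] [InnerProductSpace 𝕜 H]
  {K : Type w} [NormedAddCommGroup K] [InnerProductSpace 𝕜 K]

/-- The (componentwise) sum `{{h, k₁ + k₂} : {h, k₁} ∈ T₁, {h, k₂} ∈ T₂}` of linear relations. -/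
def relAdd (T₁ T₂ : Submodule 𝕜 (H × K)) : Submodule 𝕜 (H × K) where
  carrier := {p | ∃ k₁ k₂ : K, (p.1, k₁) ∈ T₁ ∧ (p.1, k₂) ∈ T₂ ∧ p.2 = k₁ + k₂}
  add_mem' := by
    rintro p q ⟨a, b, ha, hb, hp⟩ ⟨c, d, hc, hd, hq⟩
    refine ⟨a + c, b + d, T₁.add_mem ha hc, T₂.add_mem hb hd, ?_⟩
    rw [Prod.snd_add, hp, hq, add_add_add_comm]
  zero_mem' := ⟨0, 0, T₁.zero_mem, T₂.zero_mem, by simp⟩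
  smul_mem' := by
    rintro r p ⟨a, b, ha, hb, hp⟩
    refine ⟨r • a, r • b, T₁.smul_mem r ha, T₂.smul_mem r hb, ?_⟩
    rw [Prod.smul_snd, hp, smul_add]

/-- The product `P T = {{h, P k} : {h, k} ∈ T}` of a linear relation with an operator. -/
def opMulRel (P : K →L[𝕜] K) (T : Submodule 𝕜 (H × K)) : Submodule 𝕜 (H × K) :=
  T.map (LinearMap.prodMap LinearMap.id (P : K →ₗ[𝕜] K))

/-- A linear relation is regular if its closure is (the graph of) an operator. -/
def IsRegularRel (T : Submodule 𝕜 (H × K)) : Prop :=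
  ∀ k : K, ((0 : H), k) ∈ T.topologicalClosure → k = 0

/-- A linear relation is singular if its closure is a product of closed subspaces. -/
def IsSingularRel (T : Submodule 𝕜 (H × K)) : Prop :=
  ∃ (V : Submodule 𝕜 H) (W : Submodule 𝕜 K), IsClosed (V : Set H) ∧ IsClosed (W : Set K) ∧
    T.topologicalClosure = V.prod W

end Relations

section Parametrization

variable {𝕜 : Type x} [RCLike 𝕜]
  {E : Type u} [NormedAddCommGroup E] [InnerProductSpace 𝕜 E] [CompleteSpace E]
  {H : Type v} [NormedAddCommGroup H] [InnerProductSpace 𝕜 H] [CompleteSpace H]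
  {K : Type w} [NormedAddCommGroup K] [InnerProductSpace 𝕜 K] [CompleteSpace K]

/-- `D(A,B) = {k ∈ K : B* k ∈ ran A*}`. -/
noncomputable def spaceD (A : E →L[𝕜] H) (B : E →L[𝕜] K) : Submodule 𝕜 K :=
  (LinearMap.range (ContinuousLinearMap.adjoint A : H →ₗ[𝕜] E)).comap
    (ContinuousLinearMap.adjoint B : K →ₗ[𝕜] E)

/-- The closed subspaces `L` of `K` that parametrize the Lebesgue type decompositions. The inclusion
`L ⊂ clos D \ D` is understood for the nonzero elements, as `0 ∈ L ∩ D` always. -/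
structure IsParameter (A : E →L[𝕜] H) (B : E →L[𝕜] K) (L : Submodule 𝕜 K) : Prop where
  isClosed : IsClosed (L : Set K)
  subset : (L : Set K) \ {0} ⊆ closure (spaceD A B : Set K) \ (spaceD A B : Set K)
  closure_eq : closure ((Lᗮ : Set K) ∩ spaceD A B) = (Lᗮ : Set K) ∩ closure (spaceD A B : Set K)

/-- The closed subspace `M = D(A,B)ᗮ ⊕ L`. The topological closure only serves to have the
orthogonal projection available for every `L`; see `spaceM_eq`. -/
noncomputable def spaceM (A : E →L[𝕜] H) (B : E →L[𝕜] K) (L : Submodule 𝕜 K) : Submodule 𝕜 K :=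
  ((spaceD A B)ᗮ ⊔ L).topologicalClosure

instance instHasOrthogonalProjectionSpaceM (A : E →L[𝕜] H) (B : E →L[𝕜] K) (L : Submodule 𝕜 K) :
    (spaceM A B L).HasOrthogonalProjection :=
  inferInstanceAs ((spaceD A B)ᗮ ⊔ L).topologicalClosure.HasOrthogonalProjection

/-- The orthogonal projection `P_M` onto `M`. -/
noncomputable def projM (A : E →L[𝕜] H) (B : E →L[𝕜] K) (L : Submodule 𝕜 K) : K →L[𝕜] K :=
  (spaceM A B L).starProjection

theorem IsParameter.le_closure {A : E →L[𝕜] H} {B : E →L[𝕜] K} {L : Submodule 𝕜 K}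
    (h : IsParameter A B L) : L ≤ (spaceD A B)ᗮᗮ := by
  intro k hk
  rw [Submodule.orthogonal_orthogonal_eq_closure]
  by_cases h0 : k = 0
  · rw [h0]; exact Submodule.zero_mem _
  · exact (h.subset ⟨hk, h0⟩).1

/-- For the subspaces `L` in question, `M` is the orthogonal sum of `D(A,B)ᗮ` and `L`. -/
theorem spaceM_eq {A : E →L[𝕜] H} {B : E →L[𝕜] K} {L : Submodule 𝕜 K} (h : IsParameter A B L) :
    (spaceD A B)ᗮ ⟂ L ∧ spaceM A B L = (spaceD A B)ᗮ ⊔ L := by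
  have hL := h.le_closure
  refine ⟨Submodule.IsOrtho.symm hL, ?_⟩
  set N := (spaceD A B)ᗮ with hN
  have key : N ⊔ L = L.comap (Nᗮ.starProjection : K →ₗ[𝕜] K) := by
    apply le_antisymm
    · refine sup_le ?_ ?_
      · intro k hk
        have : Nᗮ.starProjection k = 0 :=
          (Submodule.starProjection_apply_eq_zero_iff Nᗮ).2 (Submodule.le_orthogonal_orthogonal N hk)
        simp [this]
      · intro k hk
        have : Nᗮ.starProjection k = k := Submodule.starProjection_eq_self_iff.2 (hL hk)
        simpa [this] using hk
    · intro k hk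
      have h1 : k - Nᗮ.starProjection k ∈ N := by
        have := Submodule.sub_starProjection_mem_orthogonal (K := Nᗮ) k
        rwa [Submodule.orthogonal_orthogonal] at this
      have h2 : k = (k - Nᗮ.starProjection k) + Nᗮ.starProjection k := by abel
      rw [h2]
      exact Submodule.add_mem_sup h1 hk
  have hcl : IsClosed ((N ⊔ L : Submodule 𝕜 K) : Set K) := by
    rw [key]
    exact h.isClosed.preimage Nᗮ.starProjection.continuous
  exact hcl.submodule_topologicalClosure_eq

end Parametrization

end OpLebesgue

/-!
Write `D = D(A,B)`; it is the domain of the adjoint relation `L(A,B)*`. Two facts translate the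
notions of the theorem into properties of `D` and of the adjoints.

* `B` is almost dominated by `A` if and only if `D` is dense in `K`
  (`almostDominated_iff_orthogonal_spaceD_eq_bot`). Almost domination makes `L(A,B)` closable, and the
  multivalued part of `L(A,B)**` is `Dᗮ`. Conversely, the approximants are built without spectral
  theory: `T n f` is the projection of `(B f, 0)` onto `{(k, h) : B* k = (n + 1) A* h}`.
* `B` is singular with respect to `A` if and only if `ran A*` and `ran B*` meet only in `0`
  (`singularTo_iff_disjoint_range_adjoint`), by the range inclusion of Douglas' lemma in one direction
  and rank one operators in the other.

For a closed subspace `M` one has `D(A, (1 - P_M) B) = M ⊕ (Mᗮ ⊓ D)` and `(P_M B)* = B* P_M`. Hence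
`((1 - P_M) B, P_M B)` is a Lebesgue type decomposition as soon as `Mᗮ ⊓ D` is dense in `Mᗮ` and
`M ⊓ D = 0`, and every Lebesgue type decomposition `(B₁, B₂)` arises so, from the closure `M` of
`ran B₂`. Such an `M` contains `Dᗮ`, and `M ↦ M ⊓ Dᗮᗮ`, `L ↦ Dᗮ ⊕ L` identify these subspaces with the
parameters `L` (`IsParameter.eq_spaceM_inf`, `isParameter_inf`). Finally `P_M B` determines `M`, because
`ker B* ⊆ D` meets `M` only in `0`.

The statements on relations follow from `L(A,B)** = closure L(A,B)`: regularity of `L(A,B₁)` is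
closability, and `L(A,B₂)*` is `ker B₂* × ker A*` by singularity.
-/

namespace OpLebesgue

open Filter Topology

universe u v w x

/-! ### Adjoints of linear relations -/

section Relations

variable {𝕜 : Type x} [RCLike 𝕜]
  {H : Type v} [NormedAddCommGroup H] [InnerProductSpace 𝕜 H]
  {K : Type w} [NormedAddCommGroup K] [InnerProductSpace 𝕜 K]

theorem isClosed_adjoint (T : Submodule 𝕜 (H × K)) : IsClosed (T.adjoint : Set (K × H)) := by
  rw [Submodule.adjoint, Submodule.map_coe, LinearEquiv.coe_coe, LinearEquiv.image_eq_preimage_symm]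
  exact (Submodule.isClosed_orthogonal _).preimage (WithLp.prod_continuous_toLp _ _ _)

theorem le_adjoint_adjoint (T : Submodule 𝕜 (H × K)) : T ≤ T.adjoint.adjoint := by
  rintro ⟨h, k⟩ hT
  rw [Submodule.mem_adjoint_iff]
  intro k' h' h'T
  have := (Submodule.mem_adjoint_iff _ _).1 h'T h k hT
  dsimp only at this ⊢
  rw [← inner_conj_symm h', ← inner_conj_symm k', ← map_sub, ← neg_sub, this]
  simp

/-- The bipolar theorem for linear relations: the adjoint is the orthogonal complement in the Hilbert
sum, up to the skew swap of the factors. -/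
theorem adjoint_adjoint_eq_topologicalClosure [CompleteSpace H] [CompleteSpace K]
    (T : Submodule 𝕜 (H × K)) : T.adjoint.adjoint = T.topologicalClosure := by
  refine le_antisymm ?_
    (Submodule.topologicalClosure_minimal _ (le_adjoint_adjoint T) (isClosed_adjoint _))
  rintro ⟨h, k⟩ hT
  set e := WithLp.prodContinuousLinearEquiv 2 𝕜 H K
  set T' : Submodule 𝕜 (WithLp 2 (H × K)) := T.comap (e : WithLp 2 (H × K) →ₗ[𝕜] H × K)
  have key : WithLp.toLp 2 (h, k) ∈ T'.topologicalClosure := by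
    rw [← Submodule.orthogonal_orthogonal_eq_closure, Submodule.mem_orthogonal]
    intro u hu
    have hadj : (u.snd, -u.fst) ∈ T.adjoint := by
      rw [Submodule.mem_adjoint_iff]
      intro a b hab
      have := (Submodule.mem_orthogonal _ _).1 hu (WithLp.toLp 2 (a, b)) hab
      rw [WithLp.prod_inner_apply] at this
      simpa [add_comm] using this
    have := (Submodule.mem_adjoint_iff _ _).1 hT _ _ hadj
    rw [WithLp.prod_inner_apply]
    simp only [inner_neg_left] at this
    simp only [WithLp.ofLp_fst, WithLp.ofLp_snd]
    linear_combination -this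
  have hcl : IsClosed ((T.topologicalClosure.comap
      (e : WithLp 2 (H × K) →ₗ[𝕜] H × K) : Submodule 𝕜 (WithLp 2 (H × K))) :
      Set (WithLp 2 (H × K))) :=
    T.isClosed_topologicalClosure.preimage e.continuous
  exact Submodule.topologicalClosure_minimal T'
    (Submodule.comap_mono T.le_topologicalClosure) hcl key

end Relations

/-! ### Almost domination and closability -/

section Pairs

variable {𝕜 : Type x} [RCLike 𝕜]
  {E : Type u} [NormedAddCommGroup E] [InnerProductSpace 𝕜 E]
  {H : Type v} [NormedAddCommGroup H] [InnerProductSpace 𝕜 H]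
  {K : Type w} [NormedAddCommGroup K] [InnerProductSpace 𝕜 K]

theorem mem_rel {A : E →L[𝕜] H} {B : E →L[𝕜] K} {p : H × K} :
    p ∈ rel A B ↔ ∃ f, (A f, B f) = p := Iff.rfl

/-- Almost domination forces closability. Each approximant is at most `‖B f‖`, so its value at `f m`
is bounded by the tail oscillation of `B (f m)`, uniformly in the index of the approximant. -/
theorem AlmostDominated.eq_zero_of_tendsto {A : E →L[𝕜] H} {B : E →L[𝕜] K}
    (h : AlmostDominated A B) {f : ℕ → E} {k : K} (hA : Tendsto (fun m => A (f m)) atTop (𝓝 0))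
    (hB : Tendsto (fun m => B (f m)) atTop (𝓝 k)) : k = 0 := by
  obtain ⟨X, _, _, _, T, c, hc, hT⟩ := h
  have hle : ∀ n g, ‖T n g‖ ≤ ‖B g‖ := fun n g =>
    (monotone_nat_of_le_succ (hT g).2.1).ge_of_tendsto (hT g).2.2 n
  have hT0 : ∀ n, Tendsto (fun m => T n (f m)) atTop (𝓝 0) := fun n => by
    refine squeeze_zero_norm (fun m => (hT (f m)).1 n) ?_
    simpa using (hA.norm.const_mul (c n))
  refine tendsto_nhds_unique hB (Metric.tendsto_atTop.2 fun ε hε => ?_)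
  obtain ⟨N, hN⟩ := Metric.cauchySeq_iff.1 hB.cauchySeq (ε / 2) (half_pos hε)
  refine ⟨N, fun m hm => ?_⟩
  rw [dist_zero_right]
  refine lt_of_le_of_lt (le_of_tendsto (hT (f m)).2.2 (Eventually.of_forall fun n => ?_))
    (half_lt_self hε)
  -- `T n (f m)` is the limit of `T n (f m - f l)` as `l → ∞`.
  have hlim : Tendsto (fun l => ‖T n (f m - f l)‖) atTop (𝓝 ‖T n (f m)‖) := by
    simpa using (((hT0 n).const_sub (T n (f m))).norm)
  refine le_of_tendsto hlim (eventually_atTop.2 ⟨N, fun l hl => ?_⟩)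
  refine (hle n _).trans ?_
  rw [map_sub, ← dist_eq_norm]
  exact (hN m hm l hl).le

theorem AlmostDominated.isRegularRel {A : E →L[𝕜] H} {B : E →L[𝕜] K}
    (h : AlmostDominated A B) : IsRegularRel (rel A B) := by
  intro k hk
  obtain ⟨p, hp, hlim⟩ := mem_closure_iff_seq_limit.1 hk
  choose f hf using fun n => mem_rel.1 (hp n)
  obtain rfl : (fun n => (A (f n), B (f n))) = p := funext hf
  exact h.eq_zero_of_tendsto ((continuous_fst.tendsto _).comp hlim)
    ((continuous_snd.tendsto _).comp hlim)

variable [CompleteSpace E] [CompleteSpace H] [CompleteSpace K]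

open ContinuousLinearMap (adjoint)

theorem mem_adjoint_rel {A : E →L[𝕜] H} {B : E →L[𝕜] K} {k : K} {h : H} :
    (k, h) ∈ (rel A B).adjoint ↔ adjoint B k = adjoint A h := by
  rw [Submodule.mem_adjoint_iff]
  constructor
  · intro hkh
    refine ext_inner_left 𝕜 fun f => ?_
    rw [ContinuousLinearMap.adjoint_inner_right, ContinuousLinearMap.adjoint_inner_right]
    exact sub_eq_zero.1 (hkh _ _ ⟨f, rfl⟩)
  · rintro hkh _ _ ⟨f, hf⟩
    cases hf
    exact sub_eq_zero.2 ((ContinuousLinearMap.adjoint_inner_right B f k).symm.trans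
      ((congrArg (inner 𝕜 f) hkh).trans (ContinuousLinearMap.adjoint_inner_right A f h)))

theorem mem_spaceD {A : E →L[𝕜] H} {B : E →L[𝕜] K} {k : K} :
    k ∈ spaceD A B ↔ ∃ h, adjoint A h = adjoint B k := Iff.rfl

/-- A vector `k` orthogonal to `D(A,B)`, the domain of `L(A,B)*`, gives `{0, k} ∈ L(A,B)**`. -/
theorem orthogonal_spaceD_eq_bot_of_isRegularRel {A : E →L[𝕜] H} {B : E →L[𝕜] K}
    (h : IsRegularRel (rel A B)) : (spaceD A B)ᗮ = ⊥ := by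
  refine (Submodule.eq_bot_iff _).2 fun k hk => h k ?_
  rw [← adjoint_adjoint_eq_topologicalClosure, Submodule.mem_adjoint_iff]
  intro k' h' hkh
  have := (Submodule.mem_orthogonal _ _).1 hk k' ⟨h', (mem_adjoint_rel.1 hkh).symm⟩
  simp [this]

/-! ### Approximants of an operator from below -/

/-- The closed subspace `{(k, h) : B* k = s A* h}` of the Hilbert sum of `K` and `H`. For `s ≠ 0` it
is the adjoint relation `L(A,B)*` with its second component scaled by `1 / s`. -/
noncomputable def approxSpace (A : E →L[𝕜] H) (B : E →L[𝕜] K) (s : ℝ) :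
    Submodule 𝕜 (WithLp 2 (K × H)) :=
  (adjoint B ∘L WithLp.fstL 2 𝕜 K H - (s : 𝕜) • (adjoint A ∘L WithLp.sndL 2 𝕜 K H)).ker

theorem mem_approxSpace {A : E →L[𝕜] H} {B : E →L[𝕜] K} {s : ℝ} {p : WithLp 2 (K × H)} :
    p ∈ approxSpace A B s ↔ adjoint B p.fst = (s : 𝕜) • adjoint A p.snd := by
  simp [approxSpace, sub_eq_zero]

instance (A : E →L[𝕜] H) (B : E →L[𝕜] K) (s : ℝ) : CompleteSpace (approxSpace A B s) :=
  ContinuousLinearMap.completeSpace_ker _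

/-- The approximant of `B` that sends `f` to the orthogonal projection of `(B f, 0)` onto
`approxSpace A B s`. Its squared norm at `f` is the infimum of `‖B g‖² + s² ‖A (f - g)‖²` over
`g`. -/
noncomputable def approx (A : E →L[𝕜] H) (B : E →L[𝕜] K) (s : ℝ) : E →L[𝕜] WithLp 2 (K × H) :=
  (approxSpace A B s).starProjection ∘L
    ((WithLp.prodContinuousLinearEquiv 2 𝕜 K H).symm : K × H →L[𝕜] WithLp 2 (K × H)) ∘L
    ContinuousLinearMap.inl 𝕜 K H ∘L B

theorem approx_apply (A : E →L[𝕜] H) (B : E →L[𝕜] K) (s : ℝ) (f : E) :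
    approx A B s f = (approxSpace A B s).starProjection (WithLp.toLp 2 (B f, 0)) := rfl

theorem inner_approx {A : E →L[𝕜] H} {B : E →L[𝕜] K} {s : ℝ} {p : WithLp 2 (K × H)}
    (hp : p ∈ approxSpace A B s) (f : E) :
    inner 𝕜 p (approx A B s f) = inner 𝕜 p.fst (B f) := by
  rw [approx_apply, ← Submodule.inner_starProjection_left_eq_right,
    Submodule.starProjection_eq_self_iff.2 hp, WithLp.prod_inner_apply]
  simp

theorem approx_mem (A : E →L[𝕜] H) (B : E →L[𝕜] K) (s : ℝ) (f : E) :
    approx A B s f ∈ approxSpace A B s :=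
  Submodule.starProjection_apply_mem _ _

theorem norm_approx_le (A : E →L[𝕜] H) (B : E →L[𝕜] K) (s : ℝ) (f : E) :
    ‖approx A B s f‖ ≤ ‖B f‖ := by
  rw [approx_apply]
  refine (Submodule.norm_starProjection_apply_le _ _).trans ?_
  simp

omit [CompleteSpace H] [CompleteSpace K] in
theorem norm_snd_le (p : WithLp 2 (K × H)) : ‖p.snd‖ ≤ ‖p‖ := by
  have := WithLp.prod_norm_sq_eq_of_L2 p
  exact abs_le_of_sq_le_sq' (by nlinarith [sq_nonneg ‖p.fst‖]) (norm_nonneg _) |>.2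

theorem norm_approx_le_mul (A : E →L[𝕜] H) (B : E →L[𝕜] K) {s : ℝ} (hs : 0 ≤ s) (f : E) :
    ‖approx A B s f‖ ≤ s * ‖A f‖ := by
  set p := approx A B s f with hp
  rcases (norm_nonneg p).eq_or_lt with h0 | h0
  · rw [← h0]; positivity
  refine le_of_mul_le_mul_left ?_ h0
  have h1 : inner 𝕜 p p = (s : 𝕜) * inner 𝕜 p.snd (A f) := by
    conv_lhs => rw [hp, inner_approx (approx_mem A B s f), ← hp]
    rw [← ContinuousLinearMap.adjoint_inner_left, mem_approxSpace.1 (approx_mem A B s f),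
      inner_smul_left, ContinuousLinearMap.adjoint_inner_left, RCLike.conj_ofReal]
  have h2 : ‖p‖ * ‖p‖ = s * ‖inner 𝕜 p.snd (A f)‖ := by
    rw [← inner_self_eq_norm_mul_norm (𝕜 := 𝕜), inner_self_re_eq_norm, h1, norm_mul,
      RCLike.norm_ofReal, abs_of_nonneg hs]
  rw [h2, mul_left_comm]
  refine mul_le_mul_of_nonneg_left ((norm_inner_le_norm _ _).trans ?_) hs
  exact mul_le_mul_of_nonneg_right (norm_snd_le p) (norm_nonneg _)

/-- The vector `approx A B s f = (k, h)` becomes an element of `approxSpace A B t` of no larger norm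
when `h` is scaled by `s / t`; testing `approx A B t f` against it gives the inequality. -/
theorem norm_approx_mono (A : E →L[𝕜] H) (B : E →L[𝕜] K) {s t : ℝ} (hs : 0 < s) (hst : s ≤ t)
    (f : E) : ‖approx A B s f‖ ≤ ‖approx A B t f‖ := by
  set p := approx A B s f with hp
  have ht : 0 < t := hs.trans_le hst
  rcases (norm_nonneg p).eq_or_lt with h0 | h0
  · rw [← h0]; positivity
  refine le_of_mul_le_mul_left ?_ h0
  set q : WithLp 2 (K × H) := WithLp.toLp 2 (p.fst, ((s / t : ℝ) : 𝕜) • p.snd) with hq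
  have hqt : q ∈ approxSpace A B t := by
    rw [mem_approxSpace]
    have h1 := mem_approxSpace.1 (approx_mem A B s f)
    change adjoint B p.fst = (t : 𝕜) • adjoint A (((s / t : ℝ) : 𝕜) • p.snd)
    rw [h1, map_smul, smul_smul, ← RCLike.ofReal_mul, mul_div_cancel₀ _ ht.ne']
  have hqp : ‖q‖ ≤ ‖p‖ := by
    refine abs_le_of_sq_le_sq' ?_ (norm_nonneg _) |>.2
    rw [WithLp.prod_norm_sq_eq_of_L2, WithLp.prod_norm_sq_eq_of_L2]
    change ‖p.fst‖ ^ 2 + ‖((s / t : ℝ) : 𝕜) • p.snd‖ ^ 2 ≤ _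
    rw [norm_smul, RCLike.norm_ofReal, abs_of_pos (div_pos hs ht)]
    have : s / t * ‖p.snd‖ ≤ ‖p.snd‖ :=
      mul_le_of_le_one_left (norm_nonneg _) ((div_le_one ht).2 hst)
    gcongr
  have h1 : inner 𝕜 p p = inner 𝕜 q (approx A B t f) := by
    rw [inner_approx hqt]
    conv_lhs => rw [hp, inner_approx (approx_mem A B s f), ← hp]
    rfl
  rw [← inner_self_eq_norm_mul_norm (𝕜 := 𝕜), inner_self_re_eq_norm, h1]
  exact (norm_inner_le_norm _ _).trans (mul_le_mul_of_nonneg_right hqp (norm_nonneg _))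

/-- If `D(A,B)` is dense, the operators `approx A B (n + 1)` increase to `B` in norm. For `k` in
`D(A,B)` with `B* k = A* h`, the vectors `(k, h / (n + 1))` lie in `approxSpace A B (n + 1)` and tend
to `(k, 0)`, so that the limit `l` of the norms satisfies `|⟪k, B f⟫| ≤ ‖k‖ l`; by density this holds
for `k = B f`. -/
theorem almostDominated_of_orthogonal_spaceD_eq_bot {A : E →L[𝕜] H} {B : E →L[𝕜] K}
    (h : (spaceD A B)ᗮ = ⊥) : AlmostDominated A B := by
  have hpos : ∀ n : ℕ, (0 : ℝ) < n + 1 := fun n => by positivity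
  refine ⟨fun _ => WithLp 2 (K × H), fun _ => inferInstance, fun _ => inferInstance,
    fun _ => inferInstance, fun n => approx A B (n + 1), fun n => n + 1, fun n => (hpos n).le,
    fun f => ⟨fun n => norm_approx_le_mul A B (hpos n).le f, fun n =>
      norm_approx_mono A B (hpos n) (by push_cast; linarith) f, ?_⟩⟩
  have hmono : Monotone fun n : ℕ => ‖approx A B (n + 1) f‖ :=
    monotone_nat_of_le_succ fun n => norm_approx_mono A B (hpos n) (by push_cast; linarith) f
  have hbdd : BddAbove (Set.range fun n : ℕ => ‖approx A B (n + 1) f‖) :=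
    ⟨‖B f‖, by rintro _ ⟨n, rfl⟩; exact norm_approx_le A B _ f⟩
  have hlim := tendsto_atTop_ciSup hmono hbdd
  set l := ⨆ n : ℕ, ‖approx A B (n + 1) f‖
  have hl : l ≤ ‖B f‖ := le_of_tendsto' hlim fun n => norm_approx_le A B _ f
  suffices hge : ‖B f‖ ≤ l by rwa [le_antisymm hge hl]
  have hD : ∀ k ∈ spaceD A B, ‖inner 𝕜 k (B f)‖ ≤ ‖k‖ * l := by
    intro k hk
    obtain ⟨h₀, hh⟩ := mem_spaceD.1 hk
    let p : ℕ → WithLp 2 (K × H) := fun n =>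
      WithLp.toLp 2 (k, (((1 / ((n : ℝ) + 1) : ℝ)) : 𝕜) • h₀)
    have hp : ∀ n : ℕ, p n ∈ approxSpace A B (n + 1) := fun n => by
      rw [mem_approxSpace]
      change adjoint B k = _ • adjoint A (_ • h₀)
      rw [map_smul, smul_smul, hh, ← RCLike.ofReal_mul, mul_one_div_cancel (hpos n).ne',
        RCLike.ofReal_one, one_smul]
    have hplim : Tendsto (fun n => ‖p n‖) atTop (𝓝 ‖k‖) := by
      have h0 : Tendsto (fun n : ℕ => (((1 / ((n : ℝ) + 1) : ℝ)) : 𝕜) • h₀) atTop (𝓝 0) := by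
        have := ((RCLike.continuous_ofReal (K := 𝕜)).tendsto 0).comp
          tendsto_one_div_add_atTop_nhds_zero_nat
        simpa using this.smul_const h₀
      have := (((WithLp.prod_continuous_toLp 2 K H).tendsto (k, 0)).comp
        ((tendsto_const_nhds (x := k)).prodMk_nhds h0)).norm
      have hk0 : ‖WithLp.toLp 2 (k, (0 : H))‖ = ‖k‖ := by simp
      rwa [hk0] at this
    refine ge_of_tendsto' (hplim.mul hlim) fun n => ?_
    have := inner_approx (hp n) f
    rw [show inner 𝕜 k (B f) = inner 𝕜 (p n).fst (B f) from rfl, ← this]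
    exact norm_inner_le_norm _ _
  have hBf : B f ∈ closure (spaceD A B : Set K) := by
    have : B f ∈ (spaceD A B)ᗮᗮ := by rw [h, Submodule.bot_orthogonal_eq_top]; trivial
    rwa [Submodule.orthogonal_orthogonal_eq_closure] at this
  have hcl : IsClosed {k : K | ‖inner 𝕜 k (B f)‖ ≤ ‖k‖ * l} :=
    isClosed_le (by fun_prop) (by fun_prop)
  have hfin : ‖inner 𝕜 (B f) (B f)‖ ≤ ‖B f‖ * l := closure_minimal hD hcl hBf
  rw [← inner_self_re_eq_norm, inner_self_eq_norm_mul_norm] at hfin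
  rcases (norm_nonneg (B f)).eq_or_lt with h0 | h0
  · rw [← h0]; exact Real.iSup_nonneg fun n => norm_nonneg _
  · exact le_of_mul_le_mul_left hfin h0

theorem almostDominated_iff_orthogonal_spaceD_eq_bot {A : E →L[𝕜] H} {B : E →L[𝕜] K} :
    AlmostDominated A B ↔ (spaceD A B)ᗮ = ⊥ :=
  ⟨fun h => orthogonal_spaceD_eq_bot_of_isRegularRel h.isRegularRel,
    almostDominated_of_orthogonal_spaceD_eq_bot⟩

/-! ### Singularity and the ranges of adjoints -/

/-- The range inclusion in Douglas' lemma: for given `g`, the functional `A f ↦ ⟪g, C f⟫` on `ran A`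
is bounded, and a vector of `H` that represents an extension of it is mapped to `C* g` by `A*`. -/
theorem Dominated.range_adjoint_le {G : Type*} [NormedAddCommGroup G] [InnerProductSpace 𝕜 G]
    [CompleteSpace G] {A : E →L[𝕜] H} {C : E →L[𝕜] G} (h : Dominated A C) :
    (adjoint C).range ≤ (adjoint A).range := by
  obtain ⟨c, hc, hC⟩ := h
  rintro _ ⟨g, rfl⟩
  obtain ⟨S, hS⟩ := (A : E →ₗ[𝕜] H).rangeRestrict.exists_rightInverse_of_surjective
    (LinearMap.range_rangeRestrict _)
  have hS' : ∀ y, A (S y) = (y : H) := fun y => congrArg Subtype.val (LinearMap.congr_fun hS y)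
  let φ : StrongDual 𝕜 (LinearMap.range (A : E →ₗ[𝕜] H)) :=
    LinearMap.mkContinuous ((innerSL 𝕜 g : G →ₗ[𝕜] 𝕜) ∘ₗ (C : E →ₗ[𝕜] G) ∘ₗ S) (‖g‖ * c)
      fun y => by
        refine (norm_inner_le_norm _ _).trans ?_
        rw [mul_assoc]
        refine mul_le_mul_of_nonneg_left ((hC (S y)).trans ?_) (norm_nonneg _)
        rw [hS']; rfl
  obtain ⟨ψ, hψ, -⟩ := exists_extension_norm_eq _ φ
  refine ⟨(InnerProductSpace.toDual 𝕜 H).symm ψ, ext_inner_right 𝕜 fun f => ?_⟩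
  have hker : C (f - S ⟨A f, f, rfl⟩) = 0 := by
    have := hC (f - S ⟨A f, f, rfl⟩)
    rw [map_sub A, hS', sub_self, norm_zero, mul_zero] at this
    exact norm_le_zero_iff.1 this
  rw [map_sub, sub_eq_zero] at hker
  simp only [ContinuousLinearMap.coe_coe]
  rw [ContinuousLinearMap.adjoint_inner_left, ContinuousLinearMap.adjoint_inner_left,
    InnerProductSpace.toDual_symm_apply, hker]
  exact hψ ⟨A f, f, rfl⟩

/-- The operator `f ↦ ⟪e, f⟫ e` with `e = A* h` is dominated by `A`, since `⟪e, f⟫ = ⟪h, A f⟫`. -/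
theorem dominated_rankOne {A : E →L[𝕜] H} {e : E} (he : e ∈ (adjoint A).range) :
    Dominated A ((innerSL 𝕜 e).smulRight e) := by
  obtain ⟨h, rfl⟩ := he
  simp only [ContinuousLinearMap.coe_coe]
  refine ⟨‖h‖ * ‖adjoint A h‖ + 1, by positivity, fun f => ?_⟩
  rw [ContinuousLinearMap.smulRight_apply, norm_smul, innerSL_apply_apply,
    ContinuousLinearMap.adjoint_inner_left]
  have := mul_le_mul_of_nonneg_right (norm_inner_le_norm (𝕜 := 𝕜) h (A f))
    (norm_nonneg (adjoint A h))
  nlinarith [norm_nonneg (A f)]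

theorem singularTo_iff_disjoint_range_adjoint {A : E →L[𝕜] H} {B : E →L[𝕜] K} :
    SingularTo A B ↔ Disjoint (adjoint A).range (adjoint B).range := by
  rw [Submodule.disjoint_def]
  constructor
  · intro h e hA hB
    have := congrArg (fun D : E →L[𝕜] E => D e) (h _ (dominated_rankOne hA) (dominated_rankOne hB))
    simpa using this
  · intro h D hA hB
    have : adjoint D = 0 := ContinuousLinearMap.ext fun g =>
      h _ (hA.range_adjoint_le ⟨g, rfl⟩) (hB.range_adjoint_le ⟨g, rfl⟩)
    simpa using this

end Pairs

/-! ### Lebesgue type decompositions and orthogonal projections -/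

section Projections

variable {𝕜 : Type x} [RCLike 𝕜]
  {E : Type u} [NormedAddCommGroup E] [InnerProductSpace 𝕜 E] [CompleteSpace E]
  {H : Type v} [NormedAddCommGroup H] [InnerProductSpace 𝕜 H] [CompleteSpace H]
  {K : Type w} [NormedAddCommGroup K] [InnerProductSpace 𝕜 K] [CompleteSpace K]

open ContinuousLinearMap (adjoint)

theorem adjoint_starProjection_comp (B : E →L[𝕜] K) (M : Submodule 𝕜 K)
    [M.HasOrthogonalProjection] (k : K) :
    adjoint (M.starProjection ∘L B) k = adjoint B (M.starProjection k) := by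
  refine ext_inner_right 𝕜 fun f => ?_
  rw [ContinuousLinearMap.adjoint_inner_left, ContinuousLinearMap.adjoint_inner_left]
  exact (M.inner_starProjection_left_eq_right k (B f)).symm

omit [CompleteSpace K] in
theorem one_sub_starProjection (M : Submodule 𝕜 K) [M.HasOrthogonalProjection] :
    1 - M.starProjection = Mᗮ.starProjection :=
  (Submodule.starProjection_orthogonal' M).symm

theorem spaceD_starProjection_comp (A : E →L[𝕜] H) (B : E →L[𝕜] K) (M : Submodule 𝕜 K)
    [M.HasOrthogonalProjection] :
    spaceD A (M.starProjection ∘L B) =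
      (spaceD A B).comap (M.starProjection : K →ₗ[𝕜] K) := by
  ext k
  rw [mem_spaceD, adjoint_starProjection_comp]
  rfl

omit [CompleteSpace K] in
/-- The subspace `{k : (1 - P_M) k ∈ D}` is `M ⊕ (Mᗮ ⊓ D)`, so it is dense if and only if `Mᗮ ⊓ D`
is dense in `Mᗮ`. With `D = D(A,B)` it is `D(A, (1 - P_M) B)`. -/
theorem orthogonal_comap_starProjection_orthogonal_eq_bot_iff {D M : Submodule 𝕜 K}
    [M.HasOrthogonalProjection] :
    (D.comap (Mᗮ.starProjection : K →ₗ[𝕜] K))ᗮ = ⊥ ↔ (Mᗮ ⊓ D)ᗮ ≤ M := by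
  set C := D.comap (Mᗮ.starProjection : K →ₗ[𝕜] K)
  have hCM : ∀ {k}, k ∈ C ↔ Mᗮ.starProjection k ∈ D := Iff.rfl
  constructor
  · intro h x hx
    rw [← Submodule.orthogonal_orthogonal M, ← Submodule.starProjection_apply_eq_zero_iff,
      ← Submodule.mem_bot 𝕜, ← h, Submodule.mem_orthogonal]
    intro c hc
    rw [← Submodule.inner_starProjection_left_eq_right]
    exact (Submodule.mem_orthogonal _ _).1 hx _ ⟨Submodule.starProjection_apply_mem _ _, hc⟩
  · intro h
    have h1 : Mᗮ ⊓ D ≤ C := fun k hk => by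
      rw [hCM, Submodule.starProjection_eq_self_iff.2 hk.1]; exact hk.2
    have h2 : M ≤ C := fun k hk => by
      rw [hCM, (Submodule.starProjection_apply_eq_zero_iff _).2 (M.le_orthogonal_orthogonal hk)]
      exact D.zero_mem
    refine (Submodule.eq_bot_iff _).2 fun x hx => ?_
    exact (Submodule.mem_bot 𝕜).1 (M.inf_orthogonal_eq_bot ▸
      ⟨h (Submodule.orthogonal_le h1 hx), Submodule.orthogonal_le h2 hx⟩)

/-- A closed subspace `M` that meets `D(A,B)` only in `0`, and for which `Mᗮ ⊓ D(A,B)` is dense in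
`Mᗮ`, splits `B` into a Lebesgue type decomposition. -/
theorem isLebesgueTypeDecomposition_starProjection {A : E →L[𝕜] H} {B : E →L[𝕜] K}
    {M : Submodule 𝕜 K} [M.HasOrthogonalProjection] (hdense : (Mᗮ ⊓ spaceD A B)ᗮ ≤ M)
    (hdisj : Disjoint M (spaceD A B)) :
    IsLebesgueTypeDecomposition A B ((1 - M.starProjection) ∘L B) (M.starProjection ∘L B) where
  eq_add := by ext; simp
  ran_orthogonal f g :=
    Submodule.starProjection_inner_eq_zero _ _ (Submodule.starProjection_apply_mem _ _)
  almostDominated := by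
    rw [almostDominated_iff_orthogonal_spaceD_eq_bot, one_sub_starProjection,
      spaceD_starProjection_comp]
    exact orthogonal_comap_starProjection_orthogonal_eq_bot_iff.2 hdense
  singular := by
    rw [singularTo_iff_disjoint_range_adjoint, Submodule.disjoint_def]
    rintro _ hA ⟨k, rfl⟩
    simp only [ContinuousLinearMap.coe_coe] at hA ⊢
    rw [adjoint_starProjection_comp] at hA ⊢
    rw [Submodule.disjoint_def.1 hdisj _ (Submodule.starProjection_apply_mem _ _) hA, map_zero]

namespace IsParameter

variable {A : E →L[𝕜] H} {B : E →L[𝕜] K} {L : Submodule 𝕜 K}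

theorem disjoint_spaceD (h : IsParameter A B L) : Disjoint L (spaceD A B) := by
  rw [Submodule.disjoint_def]
  intro k hL hD
  by_contra h0
  exact (h.subset ⟨hL, h0⟩).2 hD

theorem eq_spaceM_inf (h : IsParameter A B L) : L = spaceM A B L ⊓ (spaceD A B)ᗮᗮ := by
  rw [(spaceM_eq h).2, sup_comm, sup_inf_assoc_of_le _ h.le_closure,
    Submodule.inf_orthogonal_eq_bot, sup_bot_eq]

theorem disjoint_spaceM_spaceD (h : IsParameter A B L) :
    Disjoint (spaceM A B L) (spaceD A B) := by
  rw [Submodule.disjoint_def]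
  intro k hM hD
  have hL : k ∈ L := h.eq_spaceM_inf ▸ ⟨hM, Submodule.le_orthogonal_orthogonal _ hD⟩
  exact Submodule.disjoint_def.1 h.disjoint_spaceD k hL hD

theorem orthogonal_spaceM_inf (h : IsParameter A B L) :
    (spaceM A B L)ᗮ ⊓ spaceD A B = Lᗮ ⊓ spaceD A B := by
  rw [(spaceM_eq h).2, ← Submodule.inf_orthogonal, inf_right_comm,
    inf_eq_right.2 (Submodule.le_orthogonal_orthogonal _), inf_comm]

theorem orthogonal_orthogonal_inf_spaceD (h : IsParameter A B L) :
    (Lᗮ ⊓ spaceD A B)ᗮᗮ = (spaceM A B L)ᗮ := by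
  rw [(spaceM_eq h).2, ← Submodule.inf_orthogonal, Submodule.orthogonal_orthogonal_eq_closure,
    Submodule.orthogonal_orthogonal_eq_closure, inf_comm (Submodule.topologicalClosure _)]
  exact SetLike.coe_injective h.closure_eq

theorem orthogonal_orthogonal_spaceM_inf_le (h : IsParameter A B L) :
    ((spaceM A B L)ᗮ ⊓ spaceD A B)ᗮ ≤ spaceM A B L := by
  rw [h.orthogonal_spaceM_inf]
  refine (Submodule.le_orthogonal_orthogonal _).trans ?_
  rw [h.orthogonal_orthogonal_inf_spaceD, Submodule.orthogonal_orthogonal]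

theorem isLebesgueTypeDecomposition (h : IsParameter A B L) :
    IsLebesgueTypeDecomposition A B ((1 - projM A B L) ∘L B) (projM A B L ∘L B) :=
  isLebesgueTypeDecomposition_starProjection h.orthogonal_orthogonal_spaceM_inf_le
    h.disjoint_spaceM_spaceD

end IsParameter

/-- A subspace `M` that meets `D(A,B)` only in `0` is determined by `P_M B`: if `P_N x = 0`, then
`B* P_M x = B* P_N x = 0`, and `ker B*` is contained in `D(A,B)`. -/
theorem starProjection_le_of_comp_eq {A : E →L[𝕜] H} {B : E →L[𝕜] K} {M N : Submodule 𝕜 K}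
    [M.HasOrthogonalProjection] [N.HasOrthogonalProjection]
    (hdisj : Disjoint M (spaceD A B)) (h : M.starProjection ∘L B = N.starProjection ∘L B) :
    M ≤ N := by
  suffices hNM : Nᗮ ≤ Mᗮ by
    have := Submodule.orthogonal_le hNM
    rwa [Submodule.orthogonal_orthogonal, Submodule.orthogonal_orthogonal] at this
  intro x hx
  rw [← Submodule.starProjection_apply_eq_zero_iff] at hx ⊢
  refine Submodule.disjoint_def.1 hdisj _ (Submodule.starProjection_apply_mem _ _) ⟨0, ?_⟩
  simp only [ContinuousLinearMap.coe_coe]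
  rw [← adjoint_starProjection_comp, h, adjoint_starProjection_comp, hx, map_zero, map_zero]

theorem IsParameter.injOn (A : E →L[𝕜] H) (B : E →L[𝕜] K) :
    Set.InjOn (fun L => projM A B L ∘L B) {L | IsParameter A B L} := by
  intro L hL L' hL' h
  have hM : spaceM A B L = spaceM A B L' :=
    le_antisymm (starProjection_le_of_comp_eq hL.disjoint_spaceM_spaceD h)
      (starProjection_le_of_comp_eq hL'.disjoint_spaceM_spaceD h.symm)
  rw [hL.eq_spaceM_inf, hL'.eq_spaceM_inf, hM]

/-- The subspaces `M` that give Lebesgue type decompositions contain `D(A,B)ᗮ`, and cutting them down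
to the closure of `D(A,B)` yields the parameter. -/
theorem isParameter_inf {A : E →L[𝕜] H} {B : E →L[𝕜] K} {M : Submodule 𝕜 K}
    [M.HasOrthogonalProjection] (hM : IsClosed (M : Set K))
    (hdense : (Mᗮ ⊓ spaceD A B)ᗮ ≤ M) (hdisj : Disjoint M (spaceD A B)) :
    IsParameter A B (M ⊓ (spaceD A B)ᗮᗮ) ∧
      spaceM A B (M ⊓ (spaceD A B)ᗮᗮ) = M := by
  set D := spaceD A B
  have hDM : Dᗮ ≤ M := (Submodule.orthogonal_le inf_le_right).trans hdense
  have hsup : Dᗮ ⊔ M ⊓ Dᗮᗮ = M := by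
    rw [inf_comm]
    exact Submodule.sup_orthogonal_inf_of_hasOrthogonalProjection hDM
  have hMperp : Dᗮᗮ ⊓ (M ⊓ Dᗮᗮ)ᗮ = Mᗮ := by rw [Submodule.inf_orthogonal, hsup]
  have hinf : (M ⊓ Dᗮᗮ)ᗮ ⊓ D = Mᗮ ⊓ D := by
    rw [← hMperp, inf_right_comm, inf_eq_right.2 D.le_orthogonal_orthogonal, inf_comm]
  refine ⟨⟨hM.inter (Submodule.isClosed_orthogonal _), ?_, ?_⟩, ?_⟩
  · rintro k ⟨⟨hkM, hkD⟩, hk0⟩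
    refine ⟨?_, fun hk => hk0 (Submodule.disjoint_def.1 hdisj k hkM hk)⟩
    rwa [SetLike.mem_coe, Submodule.orthogonal_orthogonal_eq_closure] at hkD
  · have : ((M ⊓ Dᗮᗮ)ᗮ ⊓ D).topologicalClosure = (M ⊓ Dᗮᗮ)ᗮ ⊓ D.topologicalClosure := by
      rw [← Submodule.orthogonal_orthogonal_eq_closure, ← Submodule.orthogonal_orthogonal_eq_closure,
        hinf, inf_comm _ Dᗮᗮ, hMperp]
      refine le_antisymm ?_ (Submodule.orthogonal_le hdense)
      exact (Submodule.orthogonal_le (Submodule.orthogonal_le inf_le_left)).trans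
        (by rw [Submodule.orthogonal_orthogonal])
    exact congrArg (fun S : Submodule 𝕜 K => (S : Set K)) this
  · rw [spaceM, hsup]
    exact hM.submodule_topologicalClosure_eq

/-- Every Lebesgue type decomposition comes from a parameter, with `M` the closure of `ran B₂`. -/
theorem IsLebesgueTypeDecomposition.exists_isParameter {A : E →L[𝕜] H} {B B₁ B₂ : E →L[𝕜] K}
    (h : IsLebesgueTypeDecomposition A B B₁ B₂) :
    ∃ L, IsParameter A B L ∧ (1 - projM A B L) ∘L B = B₁ ∧ projM A B L ∘L B = B₂ := by
  set M := (B₂ : E →ₗ[𝕜] K).range.topologicalClosure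
  have hMcl : IsClosed (M : Set K) := Submodule.isClosed_topologicalClosure _
  have hMperp : Mᗮ = (B₂ : E →ₗ[𝕜] K).rangeᗮ := Submodule.orthogonal_closure _
  have hP₂ : M.starProjection ∘L B = B₂ := by
    ext f
    have h1 : B₁ f ∈ Mᗮ := by
      rw [hMperp, Submodule.mem_orthogonal']
      rintro _ ⟨g, rfl⟩
      exact h.ran_orthogonal f g
    have h2 : B₂ f ∈ M := Submodule.le_topologicalClosure _ ⟨f, rfl⟩
    rw [h.eq_add, ContinuousLinearMap.comp_apply, add_apply, map_add,
      (Submodule.starProjection_apply_eq_zero_iff M).2 h1,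
      Submodule.starProjection_eq_self_iff.2 h2, zero_add]
  have hP₁ : (1 - M.starProjection) ∘L B = B₁ := by
    rw [ContinuousLinearMap.sub_comp, hP₂, h.eq_add]
    ext f; simp
  have hdense : (Mᗮ ⊓ spaceD A B)ᗮ ≤ M := by
    rw [← orthogonal_comap_starProjection_orthogonal_eq_bot_iff, ← spaceD_starProjection_comp,
      ← one_sub_starProjection, hP₁]
    exact almostDominated_iff_orthogonal_spaceD_eq_bot.1 h.almostDominated
  have hdisj : Disjoint M (spaceD A B) := by
    rw [Submodule.disjoint_def]
    intro m hm hD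
    have hB : adjoint B m = adjoint B₂ m := by
      rw [← hP₂, adjoint_starProjection_comp, Submodule.starProjection_eq_self_iff.2 hm]
    have h0 : adjoint B₂ m = 0 :=
      Submodule.disjoint_def.1 (singularTo_iff_disjoint_range_adjoint.1 h.singular) _
        (hB ▸ hD) ⟨m, rfl⟩
    have hm' : m ∈ Mᗮ := by
      rw [hMperp, Submodule.mem_orthogonal']
      rintro _ ⟨f, rfl⟩
      rw [ContinuousLinearMap.coe_coe, ← ContinuousLinearMap.adjoint_inner_left, h0,
        inner_zero_left]
    exact (Submodule.mem_bot 𝕜).1 (M.inf_orthogonal_eq_bot ▸ ⟨hm, hm'⟩)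
  obtain ⟨hL, hLM⟩ := isParameter_inf hMcl hdense hdisj
  have hproj : projM A B (M ⊓ (spaceD A B)ᗮᗮ) = M.starProjection := by
    rw [projM]; congr
  exact ⟨_, hL, by rw [hproj, hP₁], by rw [hproj, hP₂]⟩

theorem bijOn_isParameter (A : E →L[𝕜] H) (B : E →L[𝕜] K) :
    Set.BijOn (fun L => ((1 - projM A B L) ∘L B, projM A B L ∘L B))
      {L | IsParameter A B L} {p | IsLebesgueTypeDecomposition A B p.1 p.2} := by
  refine ⟨fun L hL => IsParameter.isLebesgueTypeDecomposition hL, fun L hL L' hL' h =>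
    IsParameter.injOn A B hL hL' (congrArg Prod.snd h), ?_⟩
  rintro ⟨B₁, B₂⟩ h
  obtain ⟨L, hL, h₁, h₂⟩ := IsLebesgueTypeDecomposition.exists_isParameter h
  exact ⟨L, hL, Prod.ext h₁ h₂⟩

end Projections

/-! ### Radon-Nikodym derivatives and decompositions of the relation -/

section Relations

variable {𝕜 : Type x} [RCLike 𝕜]
  {E : Type u} [NormedAddCommGroup E] [InnerProductSpace 𝕜 E]
  {H : Type v} [NormedAddCommGroup H] [InnerProductSpace 𝕜 H]
  {K : Type w} [NormedAddCommGroup K] [InnerProductSpace 𝕜 K]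

open ContinuousLinearMap (adjoint)

theorem opMulRel_rel (P : K →L[𝕜] K) (A : E →L[𝕜] H) (B : E →L[𝕜] K) :
    opMulRel P (rel A B) = rel A (P ∘L B) := by
  rw [opMulRel, rel, rel, ← LinearMap.range_comp]
  rfl

/-- The sum of the relations `L(A,B₁)` and `L(A,B₂)` is no larger than `L(A,B)` because almost
domination makes `B₁` vanish on `ker A`. -/
theorem IsLebesgueTypeDecomposition.rel_eq_relAdd {A : E →L[𝕜] H} {B B₁ B₂ : E →L[𝕜] K}
    (h : IsLebesgueTypeDecomposition A B B₁ B₂) : rel A B = relAdd (rel A B₁) (rel A B₂) := by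
  have hB : ∀ f, B f = B₁ f + B₂ f := fun f => by rw [h.eq_add]; rfl
  apply le_antisymm
  · rintro _ ⟨f, rfl⟩
    exact ⟨B₁ f, B₂ f, ⟨f, rfl⟩, ⟨f, rfl⟩, hB f⟩
  · rintro ⟨a, k⟩ ⟨_, _, ⟨f, hf⟩, ⟨g, hg⟩, rfl⟩
    cases hf
    obtain ⟨hAg, rfl⟩ := Prod.mk.inj hg
    have hAg : A g = A f := hAg
    have hA : A (g - f) = 0 := by rw [map_sub, hAg, sub_self]
    -- `B₁` vanishes on `ker A`, so that `B₁ f = B₁ g`.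
    have h₁ : B₁ (g - f) = 0 :=
      h.almostDominated.eq_zero_of_tendsto (f := fun _ => g - f)
        (by simp only [hA]; exact tendsto_const_nhds) tendsto_const_nhds
    rw [map_sub, sub_eq_zero] at h₁
    exact ⟨g, Prod.ext hAg ((hB g).trans (by rw [h₁]; rfl))⟩

variable [CompleteSpace E] [CompleteSpace H] [CompleteSpace K]

omit [CompleteSpace E] in
theorem radonNikodym_graph {A : E →L[𝕜] H} {B : E →L[𝕜] K} (h : IsRegularRel (rel A B)) :
    (radonNikodym A B).graph = (rel A B).adjoint.adjoint := by
  refine Submodule.toLinearPMap_graph_eq _ ?_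
  rintro ⟨a, k⟩ hk rfl
  rw [adjoint_adjoint_eq_topologicalClosure] at hk
  exact h k hk

omit [CompleteSpace E] in
theorem radonNikodym_isClosed {A : E →L[𝕜] H} {B : E →L[𝕜] K} (h : IsRegularRel (rel A B)) :
    (radonNikodym A B).IsClosed := by
  rw [LinearPMap.IsClosed, radonNikodym_graph h]
  exact isClosed_adjoint _

omit [CompleteSpace E] in
theorem exists_eq_radonNikodym {A : E →L[𝕜] H} {B : E →L[𝕜] K} (h : IsRegularRel (rel A B))
    (f : E) : ∃ hf : A f ∈ (radonNikodym A B).domain, B f = radonNikodym A B ⟨A f, hf⟩ := by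
  have hmem : (A f, B f) ∈ (radonNikodym A B).graph := by
    rw [radonNikodym_graph h]
    exact le_adjoint_adjoint _ ⟨f, rfl⟩
  obtain ⟨⟨_, hy⟩, rfl, hB⟩ := (LinearPMap.mem_graph_iff _).1 hmem
  exact ⟨hy, hB.symm⟩

theorem SingularTo.isSingularRel {A : E →L[𝕜] H} {B : E →L[𝕜] K} (h : SingularTo A B) :
    IsSingularRel (rel A B) := by
  refine ⟨(adjoint A).kerᗮ, (adjoint B).kerᗮ, Submodule.isClosed_orthogonal _,
    Submodule.isClosed_orthogonal _, ?_⟩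
  rw [← adjoint_adjoint_eq_topologicalClosure]
  -- By singularity, `B* k = A* h` only if both sides vanish.
  have hadj : ∀ k a, (k, a) ∈ (rel A B).adjoint ↔ adjoint B k = 0 ∧ adjoint A a = 0 := by
    intro k a
    rw [mem_adjoint_rel]
    refine ⟨fun hka => ?_, fun ⟨h1, h2⟩ => h1.trans h2.symm⟩
    have := Submodule.disjoint_def.1 (singularTo_iff_disjoint_range_adjoint.1 h) (adjoint B k)
      ⟨a, hka.symm⟩ ⟨k, rfl⟩
    exact ⟨this, hka ▸ this⟩
  ext ⟨a, k⟩
  rw [Submodule.mem_adjoint_iff, Submodule.mem_prod, Submodule.mem_orthogonal,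
    Submodule.mem_orthogonal]
  constructor
  · refine fun hT => ⟨fun a' ha' => ?_, fun k' hk' => ?_⟩
    · simpa using hT 0 a' ((hadj _ _).2 ⟨map_zero _, ha'⟩)
    · simpa using hT k' 0 ((hadj _ _).2 ⟨hk', map_zero _⟩)
  · rintro ⟨ha, hk⟩ k' a' hka
    obtain ⟨hk', ha'⟩ := (hadj _ _).1 hka
    rw [ha a' ha', hk k' hk', sub_zero]

end Relations

end OpLebesgue

theorem theorem8p2 {𝕜 : Type*} [RCLike 𝕜]
    {E : Type*} [NormedAddCommGroup E] [InnerProductSpace 𝕜 E] [CompleteSpace E]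
    {H : Type*} [NormedAddCommGroup H] [InnerProductSpace 𝕜 H] [CompleteSpace H]
    {K : Type*} [NormedAddCommGroup K] [InnerProductSpace 𝕜 K] [CompleteSpace K]
    (A : E →L[𝕜] H) (B : E →L[𝕜] K) :
    -- the one-to-one correspondence `L ↦ ((I - P_M) B, P_M B)`
    Set.BijOn
      (fun L : Submodule 𝕜 K =>
        (((1 - OpLebesgue.projM A B L) ∘L B, OpLebesgue.projM A B L ∘L B) :
          (E →L[𝕜] K) × (E →L[𝕜] K)))
      {L | OpLebesgue.IsParameter A B L}
      {p | OpLebesgue.IsLebesgueTypeDecomposition A B p.1 p.2} ∧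
    ∀ L : Submodule 𝕜 K, OpLebesgue.IsParameter A B L →
      ∀ B₁ B₂ : E →L[𝕜] K,
        B₁ = (1 - OpLebesgue.projM A B L) ∘L B → B₂ = OpLebesgue.projM A B L ∘L B →
        -- the Radon-Nikodym derivative: `L(A,B₁)**` is a closed operator and `B₁ = R(A,B₁) A`
        ((OpLebesgue.radonNikodym A B₁).graph = (OpLebesgue.rel A B₁).adjoint.adjoint ∧
          (OpLebesgue.radonNikodym A B₁).IsClosed ∧
          ∀ f : E, ∃ hf : A f ∈ (OpLebesgue.radonNikodym A B₁).domain,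
            B₁ f = OpLebesgue.radonNikodym A B₁ ⟨A f, hf⟩) ∧
        -- the corresponding decomposition of the relation `L(A,B)`
        OpLebesgue.IsRegularRel (OpLebesgue.rel A B₁) ∧
        OpLebesgue.IsSingularRel (OpLebesgue.rel A B₂) ∧
        ∀ T₁ T₂ : Submodule 𝕜 (H × K),
          (OpLebesgue.rel A B = OpLebesgue.relAdd T₁ T₂ ∧
            T₁ = OpLebesgue.opMulRel (1 - OpLebesgue.projM A B L) (OpLebesgue.rel A B) ∧
            T₂ = OpLebesgue.opMulRel (OpLebesgue.projM A B L) (OpLebesgue.rel A B)) ↔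
          (T₁ = OpLebesgue.rel A B₁ ∧ T₂ = OpLebesgue.rel A B₂) := by
  refine ⟨OpLebesgue.bijOn_isParameter A B, ?_⟩
  rintro L hL _ _ rfl rfl
  have h := hL.isLebesgueTypeDecomposition
  have hreg := h.almostDominated.isRegularRel
  refine ⟨⟨OpLebesgue.radonNikodym_graph hreg, OpLebesgue.radonNikodym_isClosed hreg,
    OpLebesgue.exists_eq_radonNikodym hreg⟩, hreg, h.singular.isSingularRel, fun T₁ T₂ => ?_⟩
  rw [OpLebesgue.opMulRel_rel, OpLebesgue.opMulRel_rel]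
  refine ⟨fun hT => hT.2, ?_⟩
  rintro ⟨rfl, rfl⟩
  exact ⟨h.rel_eq_relAdd, rfl, rfl⟩
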